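/- Consider simple undirected uncolored graphs with at least one vertex, and first-order formulas over the vocabulary consisting of adjacency and equality, in negation normal form. The number of quantifier alternations of a formula is the maximum, over all sequences of nested quantifiers in the formula, of the number of changes between $\exists$ and $\forall$ along the sequence. Let $\mathrm{FO}^2$ denote the formulas that use only two variables (which may be quantified repeatedly). Let $\mathcal{K}$ be any class of graphs (for example, all finite graphs, or all graphs). A class $C$ of graphs is said to be defined over $\mathcal{K}$ by a sentence $\Phi$ if, for every $G \in \mathcal{K}$, $G \in C$ if and only if $G \models \Phi$. Theorem 8. If a class $C$ of graphs is definable over $\mathcal{K}$ by an $\mathrm{FO}^2$ sentence, then it is definable over $\mathcal{K}$ by an $\mathrm{FO}^2$ sentence with at most one quantifier alternation. Consequently, the quantifier alternation hierarchy of $\mathrm{FO}^2$ over uncolored graphs collapses to its second level: for every $a \ge 1$, a class is definable over $\mathcal{K}$ by an $\mathrm{FO}^2$ sentence with at most $a$ quantifier alternations if and only if it is definable over $\mathcal{K}$ by an $\mathrm{FO}^2$ sentence with at most one quantifier alternation. -/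

import Mathlib

universe u

/-- First-order formulas over the vocabulary of (uncolored) graphs, i.e. adjacency and equality,
in negation normal form, whose variables (free or bound) are among the `k` variables
indexed by `Fin k`. A variable may be quantified repeatedly. -/
inductive GraphFormula (k : ℕ) : Type
  | eq (x y : Fin k) : GraphFormula k
  | ne (x y : Fin k) : GraphFormula k
  | adj (x y : Fin k) : GraphFormula k
  | nadj (x y : Fin k) : GraphFormula k
  | and (φ ψ : GraphFormula k) : GraphFormula k
  | or (φ ψ : GraphFormula k) : GraphFormula k
  | ex (x : Fin k) (φ : GraphFormula k) : GraphFormula k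
  | all (x : Fin k) (φ : GraphFormula k) : GraphFormula k

/-- The two kinds of quantifiers. -/
inductive QuantKind : Type
  | ex : QuantKind
  | all : QuantKind
  deriving DecidableEq

namespace GraphFormula

variable {k : ℕ}

/-- The variables with a free occurrence. -/
def freeVars : GraphFormula k → Finset (Fin k)
  | eq x y => {x, y}
  | ne x y => {x, y}
  | adj x y => {x, y}
  | nadj x y => {x, y}
  | and φ ψ => φ.freeVars ∪ ψ.freeVars
  | or φ ψ => φ.freeVars ∪ ψ.freeVars
  | ex x φ => φ.freeVars.erase x
  | all x φ => φ.freeVars.erase x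

/-- A sentence is a formula without free variables. -/
def IsSentence (φ : GraphFormula k) : Prop := φ.freeVars = ∅

/-- Tarskian semantics in a graph `G` under an assignment `v` of vertices to the variables. -/
def Realize {V : Type u} (G : SimpleGraph V) : GraphFormula k → (Fin k → V) → Prop
  | eq x y, v => v x = v y
  | ne x y, v => v x ≠ v y
  | adj x y, v => G.Adj (v x) (v y)
  | nadj x y, v => ¬ G.Adj (v x) (v y)
  | and φ ψ, v => φ.Realize G v ∧ ψ.Realize G v
  | or φ ψ, v => φ.Realize G v ∨ ψ.Realize G v
  | ex x φ, v => ∃ a : V, φ.Realize G (Function.update v x a)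
  | all x φ, v => ∀ a : V, φ.Realize G (Function.update v x a)

/-- The truth value depends only on the values of the free variables. -/
theorem realize_congr {V : Type u} (G : SimpleGraph V) (φ : GraphFormula k) :
    ∀ v w : Fin k → V, (∀ x ∈ φ.freeVars, v x = w x) → (φ.Realize G v ↔ φ.Realize G w) := by
  induction φ with
  | eq x y | ne x y | adj x y | nadj x y =>
    intro v w h
    simp only [Realize, h x (by simp [freeVars]), h y (by simp [freeVars])]
  | and φ ψ h₁ h₂ | or φ ψ h₁ h₂ =>
    intro v w h
    simp only [Realize, h₁ v w fun x hx => h x (by simp [freeVars, hx]),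
      h₂ v w fun x hx => h x (by simp [freeVars, hx])]
  | ex x φ ih =>
    intro v w h
    refine exists_congr fun a => ih _ _ fun y hy => ?_
    by_cases hyx : y = x
    · subst hyx; simp
    · simpa [hyx] using h y (by simp [freeVars, hyx, hy])
  | all x φ ih =>
    intro v w h
    refine forall_congr' fun a => ih _ _ fun y hy => ?_
    by_cases hyx : y = x
    · subst hyx; simp
    · simpa [hyx] using h y (by simp [freeVars, hyx, hy])

/-- Truth of a sentence in a graph. It is used for sentences and graphs with at least one vertex
only, where it does not matter which assignment is taken. -/
def Holds {V : Type u} (φ : GraphFormula k) (G : SimpleGraph V) : Prop :=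
  ∀ v : Fin k → V, φ.Realize G v

theorem holds_iff_realize {V : Type u} (G : SimpleGraph V) (φ : GraphFormula k)
    (hφ : φ.IsSentence) (v : Fin k → V) : φ.Holds G ↔ φ.Realize G v := by
  refine ⟨fun h => h v, fun h w => (realize_congr G φ v w ?_).1 h⟩
  intro x hx
  rw [hφ] at hx
  simp at hx

/-- The maximum number of quantifier alternations along a sequence of nested quantifiers of the
formula, when the formula stands in the scope of a quantifier of kind `q` (the innermost of those
whose scope it is in), or in the scope of no quantifier (`none`). -/
def alternationsBelow : Option QuantKind → GraphFormula k → ℕ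
  | _, eq _ _ => 0
  | _, ne _ _ => 0
  | _, adj _ _ => 0
  | _, nadj _ _ => 0
  | q, and φ ψ => max (alternationsBelow q φ) (alternationsBelow q ψ)
  | q, or φ ψ => max (alternationsBelow q φ) (alternationsBelow q ψ)
  | q, ex _ φ => (if q = some .all then 1 else 0) + alternationsBelow (some .ex) φ
  | q, all _ φ => (if q = some .ex then 1 else 0) + alternationsBelow (some .all) φ

/-- The number of quantifier alternations of a formula: the maximum, over all sequences of nested
quantifiers in it, of the number of changes between `∃` and `∀` along the sequence. -/
def alternations (φ : GraphFormula k) : ℕ := alternationsBelow none φ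

end GraphFormula

/-- Classes of (simple, undirected, uncolored) graphs. -/
abbrev GraphClass : Type (u + 1) := ∀ V : Type u, SimpleGraph V → Prop

/-- The sentence `φ` defines the class `C` over the graphs in `K`: a graph of `K` belongs
to `C` exactly when it satisfies `φ`. As always for first-order structures, graphs are
taken to have at least one vertex. -/
def DefinesOver {k : ℕ} (K : GraphClass.{u}) (φ : GraphFormula k) (C : GraphClass.{u}) : Prop :=
  ∀ (V : Type u) [Nonempty V] (G : SimpleGraph V), K V G → (C V G ↔ φ.Holds G)

/-- `C` is definable over `K` in first-order logic with two variables. -/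
def FO2Definable (K C : GraphClass.{u}) : Prop :=
  ∃ φ : GraphFormula 2, φ.IsSentence ∧ DefinesOver K φ C

/-- `C` is definable over `K` in first-order logic with two variables by a sentence with at most
`a` quantifier alternations. These are the levels of the alternation hierarchy (the level
with `a` alternations being the `(a + 1)`-st). -/
def FO2DefinableAlt (a : ℕ) (K C : GraphClass.{u}) : Prop :=
  ∃ φ : GraphFormula 2, φ.IsSentence ∧ φ.alternations ≤ a ∧ DefinesOver K φ C

/-! Strip a graph alternately of its dominating and its isolated vertices. A stripped vertex has its
adjacency to every other vertex fixed by the rounds in which the two are stripped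
(`rel_iff_peeled`), while a vertex surviving n+1 rounds has both a neighbour and a non-neighbour
surviving n rounds (`exists_rel_not_peeled`). So in the two-pebble game a vertex matters only
through its type, the record of the rounds that strip it, and each move costs one round of depth.

If two graphs realise the same pairs of types, equal and distinct pairs apart, to the depth of the
rank of a sentence, they agree on that sentence (`holds_iff_of_pairsEmbed`). Being stripped by a
given round is a universal property, so the existence of a pair of given types needs one alternation
only. These existence statements are finite in number, and the sentence is equivalent to a Boolean
combination of them (`FO2DefinableAlt.of_list`). -/

namespace GraphFormula

/-! ### Negation, rank and finite conjunctions -/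

variable {k : ℕ}

/-- The negation of a formula, in negation normal form. -/
def neg : GraphFormula k → GraphFormula k
  | eq x y => ne x y
  | ne x y => eq x y
  | adj x y => nadj x y
  | nadj x y => adj x y
  | and φ ψ => or φ.neg ψ.neg
  | or φ ψ => and φ.neg ψ.neg
  | ex x φ => all x φ.neg
  | all x φ => ex x φ.neg

theorem realize_neg {V : Type u} (G : SimpleGraph V) (φ : GraphFormula k) :
    ∀ v, φ.neg.Realize G v ↔ ¬ φ.Realize G v := by
  induction φ <;> intro v <;> (simp_all [neg, Realize]; try tauto)

theorem freeVars_neg (φ : GraphFormula k) : φ.neg.freeVars = φ.freeVars := by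
  induction φ <;> simp_all [neg, freeVars]

/-- The dual quantifier. -/
def _root_.QuantKind.dual : QuantKind → QuantKind
  | .ex => .all
  | .all => .ex

/-- The enclosing quantifier has to be dualised along with those of the formula for the induction to
go through. -/
theorem alternationsBelow_neg (φ : GraphFormula k) :
    ∀ q : Option QuantKind,
      alternationsBelow (q.map QuantKind.dual) φ.neg = alternationsBelow q φ := by
  induction φ with
  | eq | ne | adj | nadj => intro q; simp [neg, alternationsBelow]
  | and φ ψ h₁ h₂ | or φ ψ h₁ h₂ => intro q; simp [neg, alternationsBelow, h₁, h₂]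
  | ex x φ ih =>
    intro q
    have := ih (some .ex)
    rcases q with _ | _ | _ <;> simp_all [neg, alternationsBelow, QuantKind.dual]
  | all x φ ih =>
    intro q
    have := ih (some .all)
    rcases q with _ | _ | _ <;> simp_all [neg, alternationsBelow, QuantKind.dual]

theorem alternations_neg (φ : GraphFormula k) : φ.neg.alternations = φ.alternations :=
  alternationsBelow_neg φ none

/-- The quantifier rank. -/
def rank : GraphFormula k → ℕ
  | eq _ _ | ne _ _ | adj _ _ | nadj _ _ => 0
  | and φ ψ | or φ ψ => max φ.rank ψ.rank
  | ex _ φ | all _ φ => φ.rank + 1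

/-- The conjunction of a list of formulas in which at most `x` is free. -/
def conj (x : Fin k) (l : List (GraphFormula k)) : GraphFormula k := l.foldr and (eq x x)

theorem realize_conj {V : Type u} (G : SimpleGraph V) (x : Fin k) (l : List (GraphFormula k))
    (v : Fin k → V) : (conj x l).Realize G v ↔ ∀ φ ∈ l, φ.Realize G v := by
  induction l with
  | nil => simp [conj, Realize]
  | cons φ l ih => simpa [conj, Realize] using fun _ => ih

theorem alternationsBelow_conj (q : Option QuantKind) (a : ℕ) (x : Fin k)
    (l : List (GraphFormula k)) (h : ∀ φ ∈ l, alternationsBelow q φ ≤ a) :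
    alternationsBelow q (conj x l) ≤ a := by
  induction l with
  | nil => simp [conj, alternationsBelow]
  | cons φ l ih => exact max_le (h φ (by simp)) (ih fun ψ hψ => h ψ (by simp [hψ]))

end GraphFormula

/-! ### Peeling off dominating and isolated vertices -/

namespace SimpleGraph

variable {V W : Type u} (G : SimpleGraph V) (H : SimpleGraph W)

/-- Adjacency for `true`, adjacency in the complement for `false`. -/
def Rel : Bool → V → V → Prop
  | true, x, y => G.Adj x y
  | false, x, y => x ≠ y ∧ ¬ G.Adj x y

variable {G H}

theorem Rel.symm {c : Bool} {x y : V} (h : G.Rel c x y) : G.Rel c y x := by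
  cases c
  · exact ⟨h.1.symm, fun h' => h.2 h'.symm⟩
  · exact SimpleGraph.Adj.symm h

theorem Rel.ne {c : Bool} {x y : V} (h : G.Rel c x y) : x ≠ y := by
  cases c
  · exact h.1
  · exact SimpleGraph.Adj.ne h

theorem not_rel_not_iff {x y : V} (hxy : x ≠ y) (c : Bool) :
    ¬ G.Rel (!c) x y ↔ G.Rel c x y := by
  cases c <;> simp [Rel, hxy]

variable (G H)

/-- The vertices removed in the first `k` rounds when, alternately, the vertices that are dominating
and the vertices that are isolated in the rest of the graph are removed, the last round being one
for dominating vertices (`true`) or isolated vertices (`false`); only the vertices removed in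
rounds of the same kind as the last one are counted. -/
def Peeled : Bool → ℕ → V → Prop
  | _, 0, _ => False
  | c, k + 1, x => ∀ y, G.Rel (!c) x y → Peeled (!c) k y

/-- The vertices `a` and `b` look the same in the first `n` rounds. -/
def Similar (n : ℕ) (a : V) (b : W) : Prop :=
  ∀ c k, k ≤ n → (G.Peeled c k a ↔ H.Peeled c k b)

/-- Every pair of vertices of `G` has a counterpart in `H`. -/
def PairsEmbed (n : ℕ) : Prop :=
  ∀ a a' : V, ∃ b b' : W, (a = a' ↔ b = b') ∧ Similar G H n a b ∧ Similar G H n a' b'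

variable {G H}

theorem Similar.mono {m n : ℕ} (hmn : m ≤ n) {a : V} {b : W} (h : Similar G H n a b) :
    Similar G H m a b :=
  fun c k hk => h c k (hk.trans hmn)

theorem Similar.symm {n : ℕ} {a : V} {b : W} (h : Similar G H n a b) : Similar H G n b a :=
  fun c k hk => (h c k hk).symm

theorem Peeled.succ {c : Bool} {k : ℕ} {x : V} (h : G.Peeled c k x) : G.Peeled c (k + 1) x := by
  induction k generalizing c x with
  | zero => exact h.elim
  | succ k ih => exact fun y hy => ih (h y hy)

theorem Peeled.mono {c : Bool} {k m : ℕ} {x : V} (h : G.Peeled c k x) (hkm : k ≤ m) :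
    G.Peeled c m x := by
  induction hkm with
  | refl => exact h
  | step _ ih => exact ih.succ

theorem Peeled.of_rel {c : Bool} {k : ℕ} {x y : V} (h : G.Peeled c k x) (hxy : G.Rel (!c) x y) :
    G.Peeled (!c) (k - 1) y := by
  cases k with
  | zero => exact h.elim
  | succ k => exact h y hxy

/-- A vertex removed in some round has its adjacency to other vertices determined by the rounds in
which these are removed. -/
theorem rel_iff_peeled {d : Bool} {k : ℕ} {a a' : V} (h : G.Peeled d (k + 1) a)
    (h' : ¬ G.Peeled d k a) (hne : a ≠ a') : G.Rel d a a' ↔ ¬ G.Peeled (!d) k a' := by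
  constructor
  · intro hr hp
    have := hp.of_rel (by simpa using hr.symm)
    rw [Bool.not_not] at this
    exact h' (this.mono (Nat.sub_le _ _))
  · intro hp
    rw [← not_rel_not_iff hne]
    exact fun hr => hp (h a' hr)

theorem exists_peeled_succ_of_peeled {d : Bool} {n : ℕ} {a : V} (h : G.Peeled d n a) :
    ∃ k < n, G.Peeled d (k + 1) a ∧ ¬ G.Peeled d k a := by
  induction n with
  | zero => exact h.elim
  | succ n ih =>
    by_cases hn : G.Peeled d n a
    · obtain ⟨k, hk, h⟩ := ih hn
      exact ⟨k, hk.trans n.lt_succ_self, h⟩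
    · exact ⟨n, n.lt_succ_self, h, hn⟩

theorem rel_iff_rel_of_iff {d c : Bool} {a a' : V} {b b' : W} (ha : a ≠ a') (hb : b ≠ b')
    (h : G.Rel d a a' ↔ H.Rel d b b') : G.Rel c a a' ↔ H.Rel c b b' := by
  have h' : G.Rel (!d) a a' ↔ H.Rel (!d) b b' := by
    rw [← not_iff_not, not_rel_not_iff ha, not_rel_not_iff hb, h]
  cases c <;> cases d <;> assumption

/-- If one of two vertices is removed, then adjacency is determined. -/
theorem Similar.rel_iff {n : ℕ} {d c : Bool} {a a' : V} {b b' : W} (hab : Similar G H (n + 1) a b)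
    (hab' : Similar G H n a' b') (ha : a ≠ a') (hb : b ≠ b')
    (h : G.Peeled d (n + 1) a ∨ G.Peeled d n a') : G.Rel c a a' ↔ H.Rel c b b' := by
  refine rel_iff_rel_of_iff (d := d) ha hb ?_
  rcases h with h | h
  -- The criterion for a vertex removed in round k+1 consults the other one at round k only; as k ≤
  -- n, depth n suffices for `a'`.
  · obtain ⟨k, hk, h₁, h₂⟩ := exists_peeled_succ_of_peeled h
    rw [rel_iff_peeled h₁ h₂ ha, rel_iff_peeled ((hab d _ hk).1 h₁)
      (fun h => h₂ ((hab d k hk.le).2 h)) hb, hab' (!d) k (Nat.le_of_lt_succ hk)]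
  · obtain ⟨k, hk, h₁, h₂⟩ := exists_peeled_succ_of_peeled h
    have hG := rel_iff_peeled h₁ h₂ ha.symm
    have hH := rel_iff_peeled ((hab' d _ hk).1 h₁) (fun h => h₂ ((hab' d k hk.le).2 h)) hb.symm
    rw [← hab (!d) k (by omega), ← hG] at hH
    exact ⟨fun h => (hH.2 h.symm).symm, fun h => (hH.1 h.symm).symm⟩

/-- A vertex that is not removed has neighbours of both kinds that are not removed. -/
theorem exists_rel_not_peeled {n : ℕ} {a : V} (h : ∀ d, ¬ G.Peeled d (n + 1) a) (c : Bool) :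
    ∃ a', G.Rel c a a' ∧ ∀ d, ¬ G.Peeled d n a' := by
  have hc := h (!c)
  simp only [Peeled, Bool.not_not, not_forall] at hc
  obtain ⟨a', hr, hp⟩ := hc
  refine ⟨a', hr, fun d hd => ?_⟩
  by_cases hdc : d = c
  · exact hp (hdc ▸ hd)
  · have hcd : c = !d := by cases c <;> cases d <;> simp_all
    subst hcd
    -- Removing `a'` with kind `d` forces its `!d`-relative `a` to be removed a round earlier.
    exact h (!d) ((hd.of_rel hr.symm).mono (by omega))

/-- The counterpart of `a'` may be `b` itself. Then `a`, `b` and `a'` share a type, and the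
counterpart of `a`, being distinct from `b`, serves instead. -/
theorem PairsEmbed.exists_ne_similar {N n : ℕ} (h : PairsEmbed G H N) (hn : n ≤ N) {a a' : V}
    {b : W} (hab : Similar G H n a b) (hne : a ≠ a') : ∃ b', b ≠ b' ∧ Similar G H n a' b' := by
  obtain ⟨b₁, b₂, he, h₁, h₂⟩ := h a a'
  by_cases hb : b = b₂
  · subst hb
    refine ⟨b₁, fun hb => hne (he.2 hb.symm), fun c k hk => ?_⟩
    rw [h₂ c k (hk.trans hn), ← hab c k hk, h₁ c k (hk.trans hn)]
  · exact ⟨b₂, hb, h₂.mono hn⟩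

/-- If `a` or `a'` is removed, types determine adjacency and any similar vertex other than `b` will
do. If neither is, `b` is not removed either, so it has a surviving relative of the required kind,
and all survivors are similar. -/
theorem PairsEmbed.exists_similar_rel {N n : ℕ} (h : PairsEmbed G H N) (hn : n ≤ N) {a a' : V}
    {b : W} (hab : Similar G H (n + 1) a b) (hne : a ≠ a') :
    ∃ b', b ≠ b' ∧ Similar G H n a' b' ∧ ∀ c, G.Rel c a a' ↔ H.Rel c b b' := by
  by_cases hd : ∃ d, G.Peeled d (n + 1) a ∨ G.Peeled d n a'
  · obtain ⟨d, hd⟩ := hd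
    obtain ⟨b', hb, hs⟩ := h.exists_ne_similar hn (hab.mono n.le_succ) hne
    exact ⟨b', hb, hs, fun c => hab.rel_iff hs hne hb hd⟩
  · push Not at hd
    obtain ⟨c, hc⟩ : ∃ c, G.Rel c a a' := by
      by_cases ht : G.Rel true a a'
      exacts [⟨_, ht⟩, ⟨false, (not_rel_not_iff hne false).1 ht⟩]
    obtain ⟨b', hr, hp⟩ := exists_rel_not_peeled
      (fun d hdb => (hd d).1 ((hab d _ le_rfl).2 hdb)) c
    exact ⟨b', hr.ne, fun d k hk => iff_of_false (fun hx => (hd d).2 (hx.mono hk))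
      (fun hx => hp d (hx.mono hk)), fun c' => rel_iff_rel_of_iff (d := c) hne hr.ne
      (iff_of_true hc hr)⟩

end SimpleGraph

/-! ### The two-pebble game -/

namespace GraphFormula

open SimpleGraph

variable {V W : Type u} {G : SimpleGraph V} {H : SimpleGraph W}

/-- Pairs of vertices that look the same in the first `n` rounds and have the same atomic type. -/
structure SimilarPairs (G : SimpleGraph V) (H : SimpleGraph W) (n : ℕ) (v : Fin 2 → V)
    (w : Fin 2 → W) : Prop where
  similar : ∀ i, Similar G H n (v i) (w i)
  eq_iff : ∀ i j, v i = v j ↔ w i = w j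
  adj_iff : ∀ i j, G.Adj (v i) (v j) ↔ H.Adj (w i) (w j)

theorem SimilarPairs.symm {n : ℕ} {v : Fin 2 → V} {w : Fin 2 → W} (h : SimilarPairs G H n v w) :
    SimilarPairs H G n w v :=
  ⟨fun i => (h.similar i).symm, fun i j => (h.eq_iff i j).symm, fun i j => (h.adj_iff i j).symm⟩

theorem fin_two_eq_or_eq_add_one (x i : Fin 2) : i = x ∨ i = x + 1 := by
  revert x i; decide

theorem fin_two_add_one_ne (x : Fin 2) : x + 1 ≠ x := by
  revert x; decide

/-- A pebble placed on the resting one is answered likewise; any other move is answered by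
`PairsEmbed.exists_similar_rel`. -/
theorem SimilarPairs.exists_update {N n : ℕ} (hGH : PairsEmbed G H N) (hn : n ≤ N)
    {v : Fin 2 → V} {w : Fin 2 → W} (h : SimilarPairs G H (n + 1) v w) (x : Fin 2) (a : V) :
    ∃ b, SimilarPairs G H n (Function.update v x a) (Function.update w x b) := by
  have hx := fin_two_add_one_ne x
  have hs := h.similar (x + 1)
  by_cases ha : v (x + 1) = a
  · subst ha
    refine ⟨w (x + 1), fun i => ?_, fun i j => ?_, fun i j => ?_⟩
    · rcases fin_two_eq_or_eq_add_one x i with rfl | rfl <;>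
        simpa [hx] using hs.mono n.le_succ
    all_goals
      rcases fin_two_eq_or_eq_add_one x i with hi | hi <;>
        rcases fin_two_eq_or_eq_add_one x j with hj | hj <;> simp [hi, hj, hx]
  · obtain ⟨b, hb, hsb, hr⟩ := hGH.exists_similar_rel hn hs ha
    have hr : G.Adj (v (x + 1)) a ↔ H.Adj (w (x + 1)) b := hr true
    refine ⟨b, fun i => ?_, fun i j => ?_, fun i j => ?_⟩
    · rcases fin_two_eq_or_eq_add_one x i with rfl | rfl
      · simpa using hsb
      · simpa [hx] using hs.mono n.le_succ
    · rcases fin_two_eq_or_eq_add_one x i with hi | hi <;>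
        rcases fin_two_eq_or_eq_add_one x j with hj | hj <;>
          simp [hi, hj, hx, ha, hb, Ne.symm ha, Ne.symm hb]
    · rcases fin_two_eq_or_eq_add_one x i with hi | hi <;>
        rcases fin_two_eq_or_eq_add_one x j with hj | hj <;>
          simp [hi, hj, hx, hr, G.adj_comm a, H.adj_comm b]

theorem SimilarPairs.realize_iff {N : ℕ} (hGH : PairsEmbed G H N) (hHG : PairsEmbed H G N)
    (φ : GraphFormula 2) : ∀ (n : ℕ), φ.rank ≤ n → n ≤ N → ∀ (v : Fin 2 → V) (w : Fin 2 → W),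
      SimilarPairs G H n v w → (φ.Realize G v ↔ φ.Realize H w) := by
  induction φ with
  | eq x y | ne x y | adj x y | nadj x y =>
    intro n _ _ v w h
    simp [Realize, h.eq_iff, h.adj_iff]
  | and φ ψ h₁ h₂ | or φ ψ h₁ h₂ =>
    intro n hr hn v w h
    simp only [rank, max_le_iff] at hr
    simp only [Realize, h₁ n hr.1 hn v w h, h₂ n hr.2 hn v w h]
  | ex x φ ih =>
    intro n hr hn v w h
    obtain ⟨n, rfl⟩ : ∃ m, n = m + 1 := Nat.exists_eq_add_one.2 (by simp only [rank] at hr; omega)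
    have ih := ih n (Nat.le_of_succ_le_succ hr) (by omega)
    constructor
    · rintro ⟨a, ha⟩
      obtain ⟨b, hb⟩ := h.exists_update hGH (by omega) x a
      exact ⟨b, (ih _ _ hb).1 ha⟩
    · rintro ⟨b, hb⟩
      obtain ⟨a, ha⟩ := h.symm.exists_update hHG (by omega) x b
      exact ⟨a, (ih _ _ ha.symm).2 hb⟩
  | all x φ ih =>
    intro n hr hn v w h
    obtain ⟨n, rfl⟩ : ∃ m, n = m + 1 := Nat.exists_eq_add_one.2 (by simp only [rank] at hr; omega)
    have ih := ih n (Nat.le_of_succ_le_succ hr) (by omega)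
    constructor
    · intro hall b
      obtain ⟨a, ha⟩ := h.symm.exists_update hHG (by omega) x b
      exact (ih _ _ ha.symm).1 (hall a)
    · intro hall a
      obtain ⟨b, hb⟩ := h.exists_update hGH (by omega) x a
      exact (ih _ _ hb).2 (hall b)

theorem holds_iff_of_pairsEmbed [Nonempty V] (φ : GraphFormula 2) (hφ : φ.IsSentence)
    (hGH : PairsEmbed G H φ.rank) (hHG : PairsEmbed H G φ.rank) : φ.Holds G ↔ φ.Holds H := by
  obtain ⟨a⟩ := ‹Nonempty V›
  obtain ⟨b, -, -, hb, -⟩ := hGH a a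
  rw [holds_iff_realize G φ hφ fun _ => a, holds_iff_realize H φ hφ fun _ => b]
  exact SimilarPairs.realize_iff hGH hHG φ _ le_rfl le_rfl _ _
    ⟨fun _ => hb, fun _ _ => by simp, fun _ _ => by simp⟩

/-! ### Types expressed by formulas -/

/-- The negation of `SimpleGraph.Rel`. -/
def notRel (c : Bool) (x y : Fin 2) : GraphFormula 2 :=
  if c then nadj x y else or (eq x y) (adj x y)

/-- `SimpleGraph.Peeled` is expressed by a formula without existential quantifiers. -/
def peeled : Bool → ℕ → Fin 2 → GraphFormula 2
  | _, 0, x => ne x x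
  | c, k + 1, x => all (x + 1) (or (notRel (!c) x (x + 1)) (peeled (!c) k (x + 1)))

theorem realize_notRel (c : Bool) (x y : Fin 2) (v : Fin 2 → V) :
    (notRel c x y).Realize G v ↔ ¬ G.Rel c (v x) (v y) := by
  cases c <;> simp [notRel, Realize, SimpleGraph.Rel, imp_iff_not_or]

theorem realize_peeled (c : Bool) (k : ℕ) :
    ∀ (x : Fin 2) (v : Fin 2 → V), (peeled c k x).Realize G v ↔ G.Peeled c k (v x) := by
  induction k generalizing c with
  | zero => intro x v; simp [peeled, Realize, Peeled]
  | succ k ih =>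
    intro x v
    simp [peeled, Realize, Peeled, realize_notRel, ih, (fin_two_add_one_ne x).symm,
      imp_iff_not_or]

theorem alternationsBelow_peeled (c : Bool) (k : ℕ) (x : Fin 2) :
    alternationsBelow (some .all) (peeled c k x) = 0 := by
  induction k generalizing c x with
  | zero => rfl
  | succ k ih => cases c <;> simp [peeled, notRel, alternationsBelow, ih]

theorem alternationsBelow_ex_peeled_le (c : Bool) (k : ℕ) (x : Fin 2) :
    alternationsBelow (some .ex) (peeled c k x) ≤ 1 := by
  cases k with
  | zero => simp [peeled, alternationsBelow]
  | succ k =>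
    have := alternationsBelow_peeled c (k + 1) x
    simp_all [peeled, alternationsBelow]

theorem alternationsBelow_neg_peeled (c : Bool) (k : ℕ) (x : Fin 2) :
    alternationsBelow (some .ex) (peeled c k x).neg = 0 :=
  (alternationsBelow_neg _ (some .all)).trans (alternationsBelow_peeled c k x)

/-- The formula saying that `t` lists the rounds up to the `n`-th in which `x` is removed. -/
noncomputable def hasType {n : ℕ} (t : Bool × Fin (n + 1) → Bool) (x : Fin 2) : GraphFormula 2 :=
  conj x ((Finset.univ : Finset (Bool × Fin (n + 1))).toList.map fun p =>
    if t p then peeled p.1 p.2 x else (peeled p.1 p.2 x).neg)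

theorem realize_hasType {n : ℕ} (t : Bool × Fin (n + 1) → Bool) (x : Fin 2) (v : Fin 2 → V) :
    (hasType t x).Realize G v ↔ ∀ p, t p = true ↔ G.Peeled p.1 p.2 (v x) := by
  simp only [hasType, realize_conj, List.forall_mem_map, Finset.mem_toList, Finset.mem_univ,
    forall_const]
  refine forall_congr' fun p => ?_
  cases t p <;> simp [realize_neg, realize_peeled]

/-- Under `∃`, the universal conjuncts cost one alternation and the negated, existential ones none.
-/
theorem alternationsBelow_hasType {n : ℕ} (t : Bool × Fin (n + 1) → Bool) (x : Fin 2) :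
    alternationsBelow (some .ex) (hasType t x) ≤ 1 := by
  refine alternationsBelow_conj _ _ _ _ (List.forall_mem_map.2 fun p _ => ?_)
  split
  · exact alternationsBelow_ex_peeled_le _ _ _
  · exact (alternationsBelow_neg_peeled _ _ _).le.trans zero_le_one

/-- The sentence saying that there are vertices, equal or distinct depending on `e`, of
types `t` and `t'`. -/
noncomputable def pairExists {n : ℕ} (e : Bool) (t t' : Bool × Fin (n + 1) → Bool) : GraphFormula 2 :=
  ex 0 (ex 1 (and (if e then eq 0 1 else ne 0 1) (and (hasType t 0) (hasType t' 1))))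

theorem isSentence_pairExists {n : ℕ} (e : Bool) (t t' : Bool × Fin (n + 1) → Bool) :
    (pairExists e t t').IsSentence := by
  refine Finset.eq_empty_of_forall_notMem fun i hi => ?_
  fin_cases i <;> simp [pairExists, freeVars] at hi

theorem alternations_pairExists {n : ℕ} (e : Bool) (t t' : Bool × Fin (n + 1) → Bool) :
    (pairExists e t t').alternations ≤ 1 := by
  have h := alternationsBelow_hasType t 0
  have h' := alternationsBelow_hasType t' 1
  cases e <;> simp [pairExists, alternations, alternationsBelow, h, h']

theorem holds_pairExists [Nonempty V] {n : ℕ} (e : Bool) (t t' : Bool × Fin (n + 1) → Bool) :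
    (pairExists e t t').Holds G ↔ ∃ a a' : V, (e = true ↔ a = a') ∧
      (∀ p, t p = true ↔ G.Peeled p.1 p.2 a) ∧ ∀ p, t' p = true ↔ G.Peeled p.1 p.2 a' := by
  obtain ⟨a⟩ := ‹Nonempty V›
  rw [holds_iff_realize G _ (isSentence_pairExists e t t') fun _ => a]
  cases e <;> simp [pairExists, Realize, realize_hasType]

theorem pairsEmbed_of_holds_pairExists [Nonempty V] [Nonempty W] {n : ℕ}
    (h : ∀ e (t t' : Bool × Fin (n + 1) → Bool),
      (pairExists e t t').Holds G → (pairExists e t t').Holds H) : PairsEmbed G H n := by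
  classical
  intro a a'
  have := h (decide (a = a')) (fun p => decide (G.Peeled p.1 p.2 a))
    (fun p => decide (G.Peeled p.1 p.2 a'))
  rw [holds_pairExists, holds_pairExists] at this
  obtain ⟨b, b', he, hb, hb'⟩ := this ⟨a, a', by simp, by simp, by simp⟩
  exact ⟨b, b', by simpa using he,
    fun c k hk => by simpa using hb (c, ⟨k, Nat.lt_succ_of_le hk⟩),
    fun c k hk => by simpa using hb' (c, ⟨k, Nat.lt_succ_of_le hk⟩)⟩

end GraphFormula

/-! ### Boolean combinations and the collapse -/

section Definability

open GraphFormula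

/-- The class of all graphs. -/
abbrev GraphClass.all : GraphClass.{u} := fun _ _ => True

variable {a : ℕ} {K C C' : GraphClass.{u}}

theorem FO2DefinableAlt.congr (h : FO2DefinableAlt a K C)
    (hCC' : ∀ (V : Type u) [Nonempty V] (G : SimpleGraph V), K V G → (C' V G ↔ C V G)) :
    FO2DefinableAlt a K C' := by
  obtain ⟨φ, hφ, ha, hd⟩ := h
  exact ⟨φ, hφ, ha, fun V _ G hK => (hCC' V G hK).trans (hd V G hK)⟩

theorem FO2DefinableAlt.of_holds {φ : GraphFormula 2} (hφ : φ.IsSentence)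
    (ha : φ.alternations ≤ a) : FO2DefinableAlt a K (fun _ G => φ.Holds G) :=
  ⟨φ, hφ, ha, fun _ _ _ _ => Iff.rfl⟩

theorem FO2DefinableAlt.not (h : FO2DefinableAlt a K C) :
    FO2DefinableAlt a K (fun V G => ¬ C V G) := by
  obtain ⟨φ, hφ, ha, hd⟩ := h
  have hφ' : φ.neg.IsSentence := (freeVars_neg φ).trans hφ
  refine ⟨φ.neg, hφ', (alternations_neg φ).trans_le ha, fun V _ G hK => ?_⟩
  let v : Fin 2 → V := fun _ => Classical.arbitrary V
  beta_reduce
  rw [hd V G hK, holds_iff_realize G _ hφ v, holds_iff_realize G _ hφ' v, realize_neg]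

theorem FO2DefinableAlt.or (h : FO2DefinableAlt a K C) (h' : FO2DefinableAlt a K C') :
    FO2DefinableAlt a K (fun V G => C V G ∨ C' V G) := by
  obtain ⟨φ, hφ, ha, hd⟩ := h
  obtain ⟨ψ, hψ, hb, he⟩ := h'
  have hs : (φ.or ψ).IsSentence := by simp_all [IsSentence, freeVars]
  refine ⟨φ.or ψ, hs, max_le ha hb, fun V _ G hK => ?_⟩
  let v : Fin 2 → V := fun _ => Classical.arbitrary V
  beta_reduce
  rw [hd V G hK, he V G hK, holds_iff_realize G _ hφ v, holds_iff_realize G _ hψ v,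
    holds_iff_realize G _ hs v]
  rfl

theorem FO2DefinableAlt.and (h : FO2DefinableAlt a K C) (h' : FO2DefinableAlt a K C') :
    FO2DefinableAlt a K (fun V G => C V G ∧ C' V G) :=
  (h.not.or h'.not).not.congr fun V _ G _ => by tauto

theorem FO2DefinableAlt.const (p : Prop) : FO2DefinableAlt a K (fun _ _ => p) := by
  have h : FO2DefinableAlt a K (fun _ _ => True) :=
    ⟨.all 0 (.eq 0 0), by simp [IsSentence, freeVars], by simp [alternations, alternationsBelow],
      fun V _ G _ => by simp [Holds, Realize]⟩
  by_cases hp : p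
  · simpa [hp] using h
  · simpa [hp] using h.not

/-- A class of graphs determined by finitely many definable classes is definable. -/
theorem FO2DefinableAlt.of_list (L : List GraphClass.{u})
    (hL : ∀ Q ∈ L, FO2DefinableAlt a GraphClass.all Q) (C : GraphClass.{u})
    (hC : ∀ (V W : Type u) [Nonempty V] [Nonempty W] (G : SimpleGraph V) (H : SimpleGraph W),
      (∀ Q ∈ L, Q V G ↔ Q W H) → C V G → C W H) : FO2DefinableAlt a GraphClass.all C := by
  induction L generalizing C with
  | nil =>
    -- With nothing to consult, `C` contains all nonempty graphs or none.
    refine (const (∃ (V : Type u) (_ : Nonempty V) (G : SimpleGraph V), C V G)).congr ?_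
    intro W _ H _
    refine ⟨fun h => ⟨W, inferInstance, H, h⟩, ?_⟩
    rintro ⟨V, _, G, hG⟩
    exact hC V W G H (by simp) hG
  | cons Q L ih =>
    have hQ := hL Q (by simp)
    have hL' : ∀ P ∈ L, FO2DefinableAlt a GraphClass.all P := fun P hP => hL P (by simp [hP])
    -- The closure of the part of `C` where `Q` has truth value `q` under agreement on `L`; it
    -- depends on `L` alone, so induction applies.
    let part (q : Prop) : GraphClass.{u} := fun W H =>
      ∃ (V : Type u) (_ : Nonempty V) (G : SimpleGraph V),
        (Q V G ↔ q) ∧ (∀ P ∈ L, P V G ↔ P W H) ∧ C V G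
    have hpart (q : Prop) : FO2DefinableAlt a GraphClass.all (part q) := by
      refine ih hL' _ ?_
      rintro W W' _ _ H H' hH ⟨V, hV, G, hq, hG, hCG⟩
      exact ⟨V, hV, G, hq, fun P hP => (hG P hP).trans (hH P hP), hCG⟩
    refine ((hQ.and (hpart True)).or (hQ.not.and (hpart False))).congr fun W _ H _ => ?_
    constructor
    · intro h
      by_cases hq : Q W H
      · exact .inl ⟨hq, W, inferInstance, H, by simpa using hq, fun _ _ => Iff.rfl, h⟩
      · exact .inr ⟨hq, W, inferInstance, H, by simpa using hq, fun _ _ => Iff.rfl, h⟩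
    · rintro (⟨hq, V, _, G, hqG, hG, hCG⟩ | ⟨hq, V, _, G, hqG, hG, hCG⟩) <;>
        exact hC V W G H (List.forall_mem_cons.2 ⟨by simp_all, hG⟩) hCG

/-- Every two-variable sentence is equivalent to one with one quantifier alternation. -/
theorem fo2DefinableAlt_one_of_holds (φ : GraphFormula 2) (hφ : φ.IsSentence) :
    FO2DefinableAlt 1 GraphClass.all.{u} (fun _ G => φ.Holds G) := by
  let T := Bool × Fin (φ.rank + 1) → Bool
  refine FO2DefinableAlt.of_list ((Finset.univ : Finset (Bool × T × T)).toList.map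
    fun p => fun _ G => (pairExists p.1 p.2.1 p.2.2).Holds G) ?_ _ ?_
  · exact List.forall_mem_map.2 fun p _ =>
      .of_holds (isSentence_pairExists _ _ _) (alternations_pairExists _ _ _)
  · intro V W _ _ G H h
    simp only [List.forall_mem_map, Finset.mem_toList, Finset.mem_univ, forall_const] at h
    exact (holds_iff_of_pairsEmbed φ hφ
      (pairsEmbed_of_holds_pairExists fun e t t' => (h (e, t, t')).1)
      (pairsEmbed_of_holds_pairExists fun e t t' => (h (e, t, t')).2)).1

theorem FO2Definable.alt_one (h : FO2Definable K C) : FO2DefinableAlt 1 K C := by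
  obtain ⟨φ, hφ, hd⟩ := h
  obtain ⟨ψ, hψ, ha, he⟩ := fo2DefinableAlt_one_of_holds φ hφ
  exact ⟨ψ, hψ, ha, fun V _ G hK => (hd V G hK).trans (he V G trivial)⟩

end Definability

/-- Over any class `K` of graphs (all graphs, all finite graphs, ...), every class definable in
two-variable logic is definable in it with one quantifier alternation, and so all levels of the
alternation hierarchy from the second on coincide. -/
theorem theorem8 (K C : GraphClass.{u}) :
    (FO2Definable K C → FO2DefinableAlt 1 K C) ∧
      ∀ a : ℕ, 1 ≤ a → (FO2DefinableAlt a K C ↔ FO2DefinableAlt 1 K C) := by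
  refine ⟨FO2Definable.alt_one, fun a ha => ⟨?_, ?_⟩⟩
  · rintro ⟨φ, hφ, -, hd⟩
    exact FO2Definable.alt_one ⟨φ, hφ, hd⟩
  · rintro ⟨φ, hφ, h1, hd⟩
    exact ⟨φ, hφ, h1.trans ha, hd⟩
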